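/- For each $n\in\mathbb N$ let $(\Omega_n,\mathcal F_n,P_n)$ be a probability space carrying random elements $D_n$ (the data) and $W_n^*$ (auxiliary variates) of Polish spaces with their Borel $\sigma$-algebras. Let $\tau_n=\tau_n(D_n)$ and $\tau_n^*=\tau_n^*(D_n,W_n^*)$ be real-valued measurable functions of these (the original and the bootstrap statistic), and let $p_n^*:=P_n(\tau_n^*\le\tau_n\mid D_n)$ be the bootstrap p-value. The bootstrap is called \emph{unconditionally valid} if $P_n(p_n^*\le q)\to q$ for every $q\in(0,1)$. Let $\mathscr D(\mathbb R)$ be the space of càdlàg functions $\mathbb R\to\mathbb R$ with the Skorokhod $J_1$ topology. (Here $x_n\to x$ iff there are increasing homeomorphisms $\lambda_n$ of $\mathbb R$ such that $\lambda_n(t)\to t$ and $x_n(\lambda_n(t))-x(t)\to0$, both uniformly for $t$ in compact sets.) A \emph{sample-path continuous random cdf} is a random element of $\mathscr D(\mathbb R)$ whose paths are almost surely continuous cumulative distribution functions. Conditional cdfs $u\mapsto P(Y\le u\mid Z)$ are formed from regular conditional distributions. \textbf{Theorem.} For each $n$ let $X_n$ be a $D_n$-measurable random element of a Polish space. Let $F$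 and $F^*$ be sample-path continuous random cdfs on a common probability space, let $X'$ be a random element, on the same space as $F$ and $F^*$, of a Polish space $\mathcal S'$, and let $X_n'$ be $X_n$-measurable random elements of $\mathcal S'$. Suppose that $F^*$ is $X'$-measurable and that $$\bigl(P_n(\tau_n\le\cdot\mid X_n),\;P_n(\tau_n^*\le\cdot\mid D_n),\;X_n'\bigr)\;\xrightarrow{\;w\;}\;(F,F^*,X')\quad\text{in } \mathscr D(\mathbb R)\times\mathscr D(\mathbb R)\times\mathcal S'.$$ If $E\{F(u)\mid F^*\}=F^*(u)$ almost surely for every $u\in\mathbb R$, then the bootstrap based on $\tau_n$ and $\tau_n^*$ is unconditionally valid. -/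

import Mathlib

open MeasureTheory ProbabilityTheory Filter Set
open scoped Topology Uniformity

namespace RandomLimitBootstrap

/-- The càdlàg functions `ℝ → ℝ`: right-continuous, with a finite left limit at every point. -/
structure Cadlag where
  toFun : ℝ → ℝ
  right_cont : ∀ t, ContinuousWithinAt toFun (Ici t) t
  left_lim : ∀ t, ∃ l, Tendsto toFun (𝓝[<] t) (𝓝 l)

namespace Cadlag

instance : CoeFun Cadlag (fun _ => ℝ → ℝ) := ⟨Cadlag.toFun⟩

/-- The basic Skorokhod `J₁` entourage of size `ε`: `y` is `ε`-close to `x` if, for some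
increasing homeomorphism `lam` of the line (the time change), `lam t` is within `ε` of `t` and
`y (lam t)` is within `ε` of `x t`, for all `|t| ≤ 1 / ε`. -/
def entourage (ε : ℝ) : Set (Cadlag × Cadlag) :=
  {p | ∃ lam : ℝ ≃o ℝ, ∀ t : ℝ, |t| ≤ ε⁻¹ →
    |lam t - t| < ε ∧ |p.2 (lam t) - p.1 t| < ε}

theorem entourage_mono {δ ε : ℝ} (hδ : 0 < δ) (h : δ ≤ ε) : entourage δ ⊆ entourage ε := by
  rintro p ⟨lam, hl⟩
  refine ⟨lam, fun t ht => ?_⟩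
  obtain ⟨h1, h2⟩ := hl t (ht.trans (inv_anti₀ hδ h))
  exact ⟨h1.trans_le h, h2.trans_le h⟩

theorem inv_double_add_le {δ : ℝ} (hδ : 0 < δ) (h : δ ≤ 1 / 2) : (2 * δ)⁻¹ + δ ≤ δ⁻¹ := by
  have h1 : (2 * δ)⁻¹ = δ⁻¹ / 2 := by rw [mul_inv]; ring
  have h2 : (2 : ℝ) ≤ δ⁻¹ := by
    rw [le_inv_comm₀ (by norm_num) hδ]; linarith
  rw [h1]; linarith

theorem entourage_symm {δ : ℝ} (hδ : 0 < δ) (h : δ ≤ 1 / 2) {x y : Cadlag}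
    (hxy : (x, y) ∈ entourage δ) : (y, x) ∈ entourage (2 * δ) := by
  obtain ⟨lam, hl⟩ := hxy
  refine ⟨lam.symm, fun s hs => ?_⟩
  have hk := inv_double_add_le hδ h
  have hpos : 0 < δ⁻¹ := inv_pos.2 hδ
  have hs' := abs_le.1 hs
  have hb1 := abs_lt.1 (hl δ⁻¹ (abs_of_pos hpos).le).1
  have hb2 := abs_lt.1 (hl (-δ⁻¹) (by rw [abs_neg]; exact (abs_of_pos hpos).le)).1
  have ht : |lam.symm s| ≤ δ⁻¹ := by
    rw [abs_le]
    constructor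
    · rw [lam.le_symm_apply]; linarith
    · rw [lam.symm_apply_le]; linarith
  obtain ⟨h1, h2⟩ := hl _ ht
  simp only [OrderIso.apply_symm_apply] at h1 h2
  rw [abs_sub_comm] at h1 h2
  exact ⟨by linarith, by simpa using (by linarith : |x (lam.symm s) - y s| < 2 * δ)⟩

theorem entourage_comp {δ : ℝ} (hδ : 0 < δ) (h : δ ≤ 1 / 2) {x y z : Cadlag}
    (hxy : (x, y) ∈ entourage δ) (hyz : (y, z) ∈ entourage δ) : (x, z) ∈ entourage (2 * δ) := by
  obtain ⟨lam, hl⟩ := hxy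
  obtain ⟨mu, hm⟩ := hyz
  refine ⟨lam.trans mu, fun t ht => ?_⟩
  have hk := inv_double_add_le hδ h
  obtain ⟨h1, h2⟩ := hl t (by linarith)
  have ht' := abs_le.1 ht
  have h1' := abs_lt.1 h1
  obtain ⟨h3, h4⟩ := hm (lam t) (abs_le.2 ⟨by linarith, by linarith⟩)
  have h3' := abs_lt.1 h3
  have h2' := abs_lt.1 h2
  have h4' := abs_lt.1 h4
  simp only [OrderIso.trans_apply] at *
  exact ⟨abs_lt.2 ⟨by linarith, by linarith⟩, abs_lt.2 ⟨by linarith, by linarith⟩⟩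

/-- The entourages of positive size form a filter basis. -/
def entourageBasis : FilterBasis (Cadlag × Cadlag) where
  sets := {V | ∃ ε : ℝ, 0 < ε ∧ V = entourage ε}
  nonempty := ⟨entourage 1, 1, one_pos, rfl⟩
  inter_sets := by
    rintro _ _ ⟨δ, hδ, rfl⟩ ⟨ε, hε, rfl⟩
    exact ⟨_, ⟨min δ ε, lt_min hδ hε, rfl⟩, subset_inter
      (entourage_mono (lt_min hδ hε) (min_le_left _ _))
      (entourage_mono (lt_min hδ hε) (min_le_right _ _))⟩

/-- The space `𝒟(ℝ)` of càdlàg functions with the Skorokhod `J₁` topology. It is given by the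
uniform structure generated by the entourages above, so that `xₙ → x` if and only if there are
increasing homeomorphisms `lamₙ` of `ℝ` with `lamₙ(t) → t` and `xₙ(lamₙ(t)) - x(t) → 0`,
both uniformly for `t` in compact sets. -/
instance : UniformSpace Cadlag :=
  UniformSpace.ofCore <| UniformSpace.Core.mkOfBasis entourageBasis
    (by
      rintro _ ⟨ε, hε, rfl⟩ x
      exact ⟨OrderIso.refl ℝ, fun t _ => by simpa using hε⟩)
    (by
      rintro _ ⟨ε, hε, rfl⟩
      have hδ : 0 < min (ε / 2) (1 / 2) := lt_min (by linarith) (by norm_num)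
      refine ⟨_, ⟨_, hδ, rfl⟩, ?_⟩
      rintro ⟨x, y⟩ hxy
      exact entourage_mono (by linarith) (by linarith [min_le_left (ε / 2) (1 / 2)])
        (entourage_symm hδ (min_le_right _ _) hxy))
    (by
      rintro _ ⟨ε, hε, rfl⟩
      have hδ : 0 < min (ε / 2) (1 / 2) := lt_min (by linarith) (by norm_num)
      refine ⟨_, ⟨_, hδ, rfl⟩, ?_⟩
      rintro ⟨x, z⟩ ⟨y, hxy, hyz⟩
      exact entourage_mono (by linarith) (by linarith [min_le_left (ε / 2) (1 / 2)])
        (entourage_comp hδ (min_le_right _ _) hxy hyz))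

/-- `𝒟(ℝ)` carries its Borel σ-algebra. -/
instance : MeasurableSpace Cadlag := borel Cadlag

instance : BorelSpace Cadlag := ⟨rfl⟩

/-- A cdf: a nondecreasing (right-continuous) function with limits `0` at `-∞` and `1` at `∞`. -/
def IsCdf (x : Cadlag) : Prop :=
  Monotone x ∧ Tendsto x atBot (𝓝 0) ∧ Tendsto x atTop (𝓝 1)

/-- The cdf `u ↦ μ (-∞, u]` of a probability measure on the line, as an element of `𝒟(ℝ)`. -/
noncomputable def ofMeasure (μ : Measure ℝ) : Cadlag where
  toFun := cdf μ
  right_cont := (cdf μ).right_continuous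
  left_lim := fun t => ⟨_, (cdf μ).mono.tendsto_leftLim t⟩

end Cadlag

/-- Weak convergence `Zₙ →ʷ Z` of random elements of a topological space `E` with its Borel
σ-algebra, where `Zₙ` and `Z` may live on different probability spaces. -/
def WeakConv {E : Type*} [TopologicalSpace E] {Ω : ℕ → Type*} {Ω' : Type*}
    [∀ n, MeasurableSpace (Ω n)] [MeasurableSpace Ω']
    (P : ∀ n, Measure (Ω n)) [∀ n, IsProbabilityMeasure (P n)]
    (Q : Measure Ω') [IsProbabilityMeasure Q]
    (Z : ∀ n, Ω n → E) (Z' : Ω' → E) : Prop :=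
  letI : MeasurableSpace E := borel E
  haveI : BorelSpace E := ⟨rfl⟩
  TendstoInDistribution Z atTop Z' P Q

/-- A sample-path continuous random cdf: a random element of `𝒟(ℝ)` whose paths are almost
surely continuous cdfs. -/
def IsContinuousRandomCdf {Ω : Type*} [MeasurableSpace Ω] (Q : Measure Ω) (F : Ω → Cadlag) :
    Prop :=
  Measurable F ∧ ∀ᵐ ω ∂Q, (F ω).IsCdf ∧ Continuous (F ω)

/-- The random conditional cdf `P(Y ≤ · | X)`, a `𝒟(ℝ)`-valued map on the sample space, obtained
from the regular conditional distribution of `Y` given `X`. -/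
noncomputable def randomCondCdf {Ω S : Type*} [MeasurableSpace Ω] [MeasurableSpace S]
    (P : Measure Ω) [IsFiniteMeasure P] (Y : Ω → ℝ) (X : Ω → S) : Ω → Cadlag :=
  fun ω => Cadlag.ofMeasure (condDistrib Y X P (X ω))

/-- The bootstrap p-value `P(τ* ≤ τ | D)`, where `D` is the data, `τ` the original and `τs` the
bootstrap statistic, all as random elements on the same probability space. -/
noncomputable def bootstrapPValue {Ω S : Type*} [MeasurableSpace Ω] [MeasurableSpace S]
    (P : Measure Ω) (D : Ω → S) (τ τs : Ω → ℝ) : Ω → ℝ :=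
  P⟦{ω | τs ω ≤ τ ω} | MeasurableSpace.comap D inferInstance⟧

/-- Unconditional validity of the bootstrap: `P(pₙ* ≤ q) → q` for every `q ∈ (0, 1)`. -/
def UnconditionallyValid {Ω S : ℕ → Type*} [∀ n, MeasurableSpace (Ω n)]
    [∀ n, MeasurableSpace (S n)] (P : ∀ n, Measure (Ω n)) (D : ∀ n, Ω n → S n)
    (τ τs : ∀ n, Ω n → ℝ) : Prop :=
  ∀ q ∈ Ioo (0 : ℝ) 1,
    Tendsto (fun n => (P n).real {ω | bootstrapPValue (P n) (D n) (τ n) (τs n) ω ≤ q})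
      atTop (𝓝 q)

end RandomLimitBootstrap

namespace RandomLimitBootstrap

namespace Cadlag

theorem hasBasis_uniformity : (𝓤 Cadlag).HasBasis (fun ε : ℝ => 0 < ε) entourage := by
  refine ⟨fun V => ?_⟩
  change V ∈ entourageBasis.filter ↔ _
  rw [FilterBasis.mem_filter_iff]
  constructor
  · rintro ⟨_, ⟨ε, hε, rfl⟩, h⟩
    exact ⟨ε, hε, h⟩
  · rintro ⟨ε, hε, h⟩
    exact ⟨_, ⟨ε, hε, rfl⟩, h⟩

instance : (𝓤 Cadlag).IsCountablyGenerated := by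
  have h : (𝓤 Cadlag).HasBasis (fun _ : ℕ => True) (fun n : ℕ => entourage (1 / (n + 1))) := by
    refine hasBasis_uniformity.to_hasBasis (fun ε hε => ?_) fun n _ => ?_
    · obtain ⟨n, hn⟩ := exists_nat_one_div_lt hε
      exact ⟨n, trivial, entourage_mono (by positivity) hn.le⟩
    · exact ⟨1 / (n + 1), by positivity, subset_rfl⟩
  exact HasCountableBasis.isCountablyGenerated ⟨h, to_countable _⟩

theorem setOf_mem_entourage_mem_nhds (x : Cadlag) {ε : ℝ} (hε : 0 < ε) :
    {y | (y, x) ∈ entourage ε} ∈ 𝓝 x := by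
  rw [nhds_eq_comap_uniformity']
  exact preimage_mem_comap (hasBasis_uniformity.mem_of_mem hε)

/-- Evaluation at `u` is continuous at the functions that are continuous at `u`. -/
theorem continuousAt_eval {x : Cadlag} {u : ℝ} (hx : ContinuousAt x u) :
    ContinuousAt (fun y : Cadlag => y u) x := by
  rw [Metric.continuousAt_iff'] at *
  intro ε hε
  obtain ⟨δ, hδ, hδ'⟩ := Metric.eventually_nhds_iff.1 (hx (ε / 2) (by positivity))
  have hη : 0 < min (min δ (ε / 2)) (|u| + 1)⁻¹ := by positivity
  filter_upwards [setOf_mem_entourage_mem_nhds x hη] with y hy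
  obtain ⟨lam, hl⟩ := hy
  have hu : |u| ≤ (min (min δ (ε / 2)) (|u| + 1)⁻¹)⁻¹ := by
    refine le_trans ?_ (inv_anti₀ hη (min_le_right _ _))
    rw [inv_inv]
    linarith
  obtain ⟨h1, h2⟩ := hl u hu
  have h3 := hδ' (y := lam u) (h1.trans_le ((min_le_left _ _).trans (min_le_left _ _)))
  have h4 := h2.trans_le ((min_le_left _ _).trans (min_le_right _ _))
  rw [Real.dist_eq] at *
  simp only at h4
  rw [abs_lt] at *
  constructor <;> linarith [h3.1, h3.2, h4.1, h4.2]

end Cadlag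

section ContinuousMapping

variable {E Y : Type*} [TopologicalSpace E] [MeasurableSpace E] [OpensMeasurableSpace E]
  [PseudoMetricSpace Y] [MeasurableSpace Y] [BorelSpace Y]

theorem aemeasurable_of_ae_continuousAt {ν : Measure E} {φ : E → Y}
    (h : ∀ᵐ x ∂ν, ContinuousAt φ x) : AEMeasurable φ ν := by
  have hm : MeasurableSet {x | ContinuousAt φ x} := measurableSet_of_continuousAt φ
  have h1 : ContinuousOn φ {x | ContinuousAt φ x} := fun x hx =>
    ContinuousAt.continuousWithinAt hx
  have h2 := h1.aemeasurable (μ := ν) hm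
  have h3 : ν.restrict {x | ContinuousAt φ x} = ν := Measure.restrict_eq_self_of_ae_mem h
  rwa [h3] at h2

/-- A function that is a.s. continuous at a random element agrees with a measurable function at
this random element. -/
theorem exists_measurable_comp_ae_eq {Ω : Type*} [MeasurableSpace Ω] {Q : Measure Ω} {Z : Ω → E}
    (hZ : AEMeasurable Z Q) {φ : E → Y} (h : ∀ᵐ ω ∂Q, ContinuousAt φ (Z ω)) :
    ∃ φ' : E → Y, Measurable φ' ∧ ∀ᵐ ω ∂Q, φ (Z ω) = φ' (Z ω) := by
  have h1 : AEMeasurable φ (Q.map Z) := aemeasurable_of_ae_continuousAt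
    ((ae_map_iff hZ (measurableSet_of_continuousAt φ)).2 h)
  exact ⟨h1.mk φ, h1.measurable_mk, ae_of_ae_map hZ h1.ae_eq_mk⟩

/-- The continuous mapping theorem for a map that is a.s. continuous at the limit. -/
theorem _root_.MeasureTheory.TendstoInDistribution.comp_of_ae_continuousAt
    [HasOuterApproxClosed E] {Ω : ℕ → Type*} {Ω' : Type*}
    [∀ n, MeasurableSpace (Ω n)] [MeasurableSpace Ω']
    {P : ∀ n, Measure (Ω n)} [∀ n, IsProbabilityMeasure (P n)]
    {Q : Measure Ω'} [IsProbabilityMeasure Q] {Z : ∀ n, Ω n → E} {Z' : Ω' → E}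
    (h : TendstoInDistribution Z atTop Z' P Q) {φ : E → Y}
    (hφ : ∀ᵐ ω ∂Q, ContinuousAt φ (Z' ω)) (hm : ∀ n, AEMeasurable (fun ω => φ (Z n ω)) (P n)) :
    TendstoInDistribution (fun n ω => φ (Z n ω)) atTop (fun ω => φ (Z' ω)) P Q := by
  obtain ⟨φ', hφ', hae⟩ := exists_measurable_comp_ae_eq h.aemeasurable_limit hφ
  have hlim : AEMeasurable (fun ω => φ (Z' ω)) Q :=
    (hφ'.comp_aemeasurable h.aemeasurable_limit).congr (hae.mono fun _ h => h.symm)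
  refine ⟨hm, hlim, tendsto_of_forall_isClosed_limsup_le' fun B hB => ?_⟩
  have hcl : MeasurableSet (closure (φ ⁻¹' B)) := isClosed_closure.measurableSet
  have h1 := ProbabilityMeasure.limsup_measure_closed_le_of_tendsto h.tendsto
    (isClosed_closure (s := φ ⁻¹' B))
  refine (limsup_le_limsup (Eventually.of_forall fun n => ?_)).trans (h1.trans ?_)
  · simp only [ProbabilityMeasure.coe_mk]
    rw [Measure.map_apply_of_aemeasurable (hm n) hB.measurableSet,
      Measure.map_apply_of_aemeasurable (h.forall_aemeasurable n) hcl]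
    exact measure_mono fun ω hω => subset_closure hω
  · simp only [ProbabilityMeasure.coe_mk]
    rw [Measure.map_apply_of_aemeasurable hlim hB.measurableSet,
      Measure.map_apply_of_aemeasurable h.aemeasurable_limit hcl]
    refine measure_mono_ae ?_
    filter_upwards [hφ] with ω hω hmem
    have := mem_closure_image hω hmem
    exact hB.closure_subset_iff.2 (image_preimage_subset φ B) this

end ContinuousMapping

/-- Weak convergence implies convergence of the expectations of bounded real functions that are
a.s. continuous at the limit. -/
theorem WeakConv.tendsto_integral {E : Type*} [TopologicalSpace E]
    [TopologicalSpace.PseudoMetrizableSpace E] {Ω : ℕ → Type*} {Ω' : Type*}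
    [∀ n, MeasurableSpace (Ω n)] [MeasurableSpace Ω']
    {P : ∀ n, Measure (Ω n)} [∀ n, IsProbabilityMeasure (P n)]
    {Q : Measure Ω'} [IsProbabilityMeasure Q] {Z : ∀ n, Ω n → E} {Z' : Ω' → E}
    (h : WeakConv P Q Z Z') {φ : E → ℝ} (hb : ∃ C, ∀ x, |φ x| ≤ C)
    (hφ : ∀ᵐ ω ∂Q, ContinuousAt φ (Z' ω)) (hm : ∀ n, AEMeasurable (fun ω => φ (Z n ω)) (P n)) :
    Tendsto (fun n => ∫ ω, φ (Z n ω) ∂P n) atTop (𝓝 (∫ ω, φ (Z' ω) ∂Q)) := by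
  let _ : MeasurableSpace E := borel E
  have : BorelSpace E := ⟨rfl⟩
  let _ : PseudoMetricSpace E := TopologicalSpace.pseudoMetrizableSpacePseudoMetric E
  have h1 : TendstoInDistribution (fun n ω => φ (Z n ω)) atTop (fun ω => φ (Z' ω)) P Q :=
    TendstoInDistribution.comp_of_ae_continuousAt h hφ hm
  obtain ⟨C, hC⟩ := hb
  let g : BoundedContinuousFunction ℝ ℝ := BoundedContinuousFunction.ofNormedAddCommGroup
    (fun x => max (-C) (min C x)) (by fun_prop) |C| (fun x => by
      rw [Real.norm_eq_abs, abs_le]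
      exact ⟨(neg_le_neg (le_abs_self C)).trans (le_max_left _ _),
        max_le (neg_le_abs C) ((min_le_left _ _).trans (le_abs_self C))⟩)
  have hg : ∀ x, g (φ x) = φ x := fun x => by
    have := abs_le.1 (hC x)
    change max (-C) (min C (φ x)) = φ x
    rw [min_eq_right this.2, max_eq_right this.1]
  have h2 := (ProbabilityMeasure.tendsto_iff_forall_integral_tendsto.1 h1.tendsto) g
  simp only [ProbabilityMeasure.coe_mk] at h2
  rw [integral_map h1.aemeasurable_limit g.continuous.aestronglyMeasurable] at h2
  simp_rw [integral_map (h1.forall_aemeasurable _) g.continuous.aestronglyMeasurable, hg] at h2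
  exact h2

/-- The truncation of a real number to `[0, 1]`. -/
def clamp (r : ℝ) : ℝ := max 0 (min 1 r)

theorem continuous_clamp : Continuous clamp := by unfold clamp; fun_prop

theorem clamp_mem (r : ℝ) : clamp r ∈ Icc (0 : ℝ) 1 :=
  ⟨le_max_left _ _, max_le zero_le_one (min_le_left _ _)⟩

theorem clamp_eq_self {r : ℝ} (hr : r ∈ Icc (0 : ℝ) 1) : clamp r = r := by
  rw [clamp, min_eq_right hr.2, max_eq_right hr.1]

theorem monotone_clamp : Monotone clamp := fun _ _ h => max_le_max le_rfl (min_le_min le_rfl h)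

/-- The values of `x : ℝ → ℝ`, truncated to `[0, 1]`, at `-∞, u 0, …, u (N - 1), ∞`, where the
value is `0` at `-∞` and `1` at `∞`. -/
def gridVal (N : ℕ) (u : ℕ → ℝ) (x : ℝ → ℝ) : ℕ → ℝ
  | 0 => 0
  | i + 1 => if i < N then clamp (x (u i)) else 1

/-- The increments of `gridVal`. -/
def gridInc (N : ℕ) (u : ℕ → ℝ) (x : ℝ → ℝ) (i : ℕ) : ℝ :=
  gridVal N u x (i + 1) - gridVal N u x i

/-- The largest increment of `gridVal`. -/
noncomputable def gridOsc (N : ℕ) (u : ℕ → ℝ) (x : ℝ → ℝ) : ℝ :=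
  (Finset.range (N + 1)).sup' Finset.nonempty_range_add_one (gridInc N u x)

section Grid

variable {N : ℕ} {u : ℕ → ℝ} {x : ℝ → ℝ}

theorem gridVal_mem (i : ℕ) : gridVal N u x i ∈ Icc (0 : ℝ) 1 := by
  cases i with
  | zero => simp [gridVal]
  | succ i =>
    rw [gridVal]
    split_ifs
    · exact clamp_mem _
    · simp

theorem abs_gridInc_le (i : ℕ) : |gridInc N u x i| ≤ 1 := by
  have h1 := gridVal_mem (N := N) (u := u) (x := x) (i + 1)
  have h2 := gridVal_mem (N := N) (u := u) (x := x) i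
  rw [gridInc, abs_le]
  constructor <;> linarith [h1.1, h1.2, h2.1, h2.2]

theorem gridInc_le_gridOsc {i : ℕ} (hi : i < N + 1) : gridInc N u x i ≤ gridOsc N u x :=
  Finset.le_sup' (gridInc N u x) (Finset.mem_range.2 hi)

theorem abs_gridOsc_le : |gridOsc N u x| ≤ 1 := by
  rw [abs_le]
  constructor
  · exact (abs_le.1 (abs_gridInc_le 0)).1.trans (gridInc_le_gridOsc (Nat.succ_pos N))
  · exact Finset.sup'_le _ _ fun i _ => (abs_le.1 (abs_gridInc_le i)).2

theorem gridInc_nonneg (hx : Monotone x) (hu : Monotone u) (i : ℕ) : 0 ≤ gridInc N u x i := by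
  rw [gridInc, sub_nonneg]
  cases i with
  | zero => exact (gridVal_mem 1).1
  | succ i =>
    rw [gridVal, gridVal]
    split_ifs
    all_goals first
      | exact monotone_clamp (hx (hu (Nat.le_succ i)))
      | exact (clamp_mem _).2
      | exact le_rfl
      | omega

theorem gridOsc_nonneg (hx : Monotone x) (hu : Monotone u) : 0 ≤ gridOsc N u x :=
  (gridInc_nonneg hx hu 0).trans (gridInc_le_gridOsc (Nat.succ_pos N))

theorem sum_gridInc : ∑ i ∈ Finset.range (N + 1), gridInc N u x i = 1 := by
  unfold gridInc
  rw [Finset.sum_range_sub]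
  simp [gridVal]

theorem aemeasurable_gridVal {α : Type*} [MeasurableSpace α] {μ : Measure α} {x : α → ℝ → ℝ}
    (hx : ∀ t, AEMeasurable (fun a => x a t) μ) (i : ℕ) :
    AEMeasurable (fun a => gridVal N u (x a) i) μ := by
  cases i with
  | zero => exact aemeasurable_const
  | succ i =>
    simp only [gridVal]
    split_ifs
    · exact continuous_clamp.measurable.comp_aemeasurable (hx _)
    · exact aemeasurable_const

theorem continuousAt_gridVal {α : Type*} [TopologicalSpace α] {x : α → ℝ → ℝ} {a : α}
    (hx : ∀ t, ContinuousAt (fun b => x b t) a) (i : ℕ) :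
    ContinuousAt (fun b => gridVal N u (x b) i) a := by
  cases i with
  | zero => exact continuousAt_const
  | succ i =>
    simp only [gridVal]
    split_ifs
    · exact continuous_clamp.continuousAt.comp (hx _)
    · exact continuousAt_const

theorem aemeasurable_gridInc {α : Type*} [MeasurableSpace α] {μ : Measure α} {x : α → ℝ → ℝ}
    (hx : ∀ t, AEMeasurable (fun a => x a t) μ) (i : ℕ) :
    AEMeasurable (fun a => gridInc N u (x a) i) μ :=
  (aemeasurable_gridVal hx _).sub (aemeasurable_gridVal hx _)

theorem continuousAt_gridInc {α : Type*} [TopologicalSpace α] {x : α → ℝ → ℝ} {a : α}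
    (hx : ∀ t, ContinuousAt (fun b => x b t) a) (i : ℕ) :
    ContinuousAt (fun b => gridInc N u (x b) i) a :=
  (continuousAt_gridVal hx _).sub (continuousAt_gridVal hx _)

theorem aemeasurable_gridOsc {α : Type*} [MeasurableSpace α] {μ : Measure α} {x : α → ℝ → ℝ}
    (hx : ∀ t, AEMeasurable (fun a => x a t) μ) :
    AEMeasurable (fun a => gridOsc N u (x a)) μ := by
  have h : (fun a => gridOsc N u (x a)) = (Finset.range (N + 1)).sup'
      Finset.nonempty_range_add_one fun i a => gridInc N u (x a) i := by
    ext a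
    rw [gridOsc, Finset.sup'_apply]
  rw [h]
  exact Finset.sup'_induction _ _ (p := fun f => AEMeasurable f μ) (fun _ h1 _ h2 => h1.sup h2)
    fun i _ => aemeasurable_gridInc hx i

theorem continuousAt_gridOsc {α : Type*} [TopologicalSpace α] {x : α → ℝ → ℝ} {a : α}
    (hx : ∀ t, ContinuousAt (fun b => x b t) a) :
    ContinuousAt (fun b => gridOsc N u (x b)) a :=
  ContinuousAt.finset_sup'_apply _ fun i _ => continuousAt_gridInc hx i

/-- The unit step at `t`, the cdf of the point mass at `t`. -/
noncomputable def step (t v : ℝ) : ℝ := if t ≤ v then 1 else 0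

theorem monotone_step (t : ℝ) : Monotone (step t) := by
  intro a b hab
  unfold step
  split_ifs with h1 h2 h2
  · exact le_rfl
  · exact absurd (h1.trans hab) h2
  · exact zero_le_one
  · exact le_rfl

theorem gridVal_le_apply (hx : ∀ v, x v ∈ Icc (0 : ℝ) 1) (hm : Monotone x) {t : ℝ} {i : ℕ}
    (hi : i < N + 1) (h : gridInc N u (step t) i ≠ 0) (hu : Monotone u) :
    x t ∈ Icc (gridVal N u x i) (gridVal N u x (i + 1)) := by
  have hstep : ∀ v, step t v ∈ Icc (0 : ℝ) 1 := fun v => by unfold step; split_ifs <;> simp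
  have hpos : gridVal N u (step t) i < gridVal N u (step t) (i + 1) :=
    sub_pos.1 ((gridInc_nonneg (monotone_step t) hu i).lt_of_ne' h)
  constructor
  · cases i with
    | zero => exact (hx t).1
    | succ i =>
      have hiN : i < N := by omega
      rw [gridVal, if_pos hiN, clamp_eq_self (hstep _)] at hpos
      rw [gridVal, if_pos hiN, clamp_eq_self (hx _)]
      have h1 : ¬ t ≤ u i := fun hle => by
        rw [step, if_pos hle] at hpos
        exact absurd (gridVal_mem _).2 hpos.not_ge
      exact hm (not_le.1 h1).le
  · rw [gridVal] at hpos ⊢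
    split_ifs at hpos ⊢ with hiN
    · rw [clamp_eq_self (hstep _)] at hpos
      rw [clamp_eq_self (hx _)]
      have h1 : t ≤ u i := by
        by_contra hle
        rw [step, if_neg hle] at hpos
        exact absurd (gridVal_mem _).1 hpos.not_ge
      exact hm h1
    · exact (hx t).2

/-- Approximation of `h (x t)` by a linear function of the increments of the unit step at `t`. -/
theorem abs_sub_sum_step_le (hx : ∀ v, x v ∈ Icc (0 : ℝ) 1) (hm : Monotone x) (hu : Monotone u)
    {h : ℝ → ℝ} {K : NNReal} (hh : LipschitzWith K h) (c : ℕ → ℝ) (t : ℝ) :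
    |h (x t) - ∑ i ∈ Finset.range (N + 1), c i * gridInc N u (step t) i| ≤
      K * gridOsc N u x + ∑ i ∈ Finset.range (N + 1), |h (gridVal N u x (i + 1)) - c i| := by
  set w := gridInc N u (step t) with hw
  have hw0 : ∀ i, 0 ≤ w i := gridInc_nonneg (monotone_step t) hu
  have hw1 : ∀ i, w i ≤ 1 := fun i => (abs_le.1 (abs_gridInc_le i)).2
  have hsum : ∑ i ∈ Finset.range (N + 1), w i = 1 := sum_gridInc
  have h1 : h (x t) - ∑ i ∈ Finset.range (N + 1), c i * w i =
      ∑ i ∈ Finset.range (N + 1), w i * (h (x t) - c i) := by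
    simp_rw [mul_sub, Finset.sum_sub_distrib, ← Finset.sum_mul, hsum, one_mul, mul_comm]
  have h2 : (K : ℝ) * gridOsc N u x = ∑ i ∈ Finset.range (N + 1), w i * (K * gridOsc N u x) := by
    rw [← Finset.sum_mul, hsum, one_mul]
  rw [h1, h2, ← Finset.sum_add_distrib]
  refine (Finset.abs_sum_le_sum_abs _ _).trans (Finset.sum_le_sum fun i hi => ?_)
  rw [abs_mul, abs_of_nonneg (hw0 i)]
  have hi' := Finset.mem_range.1 hi
  rcases eq_or_ne (w i) 0 with h0 | h0
  · rw [h0]; simp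
  · obtain ⟨h3, h4⟩ := gridVal_le_apply hx hm hi' h0 hu
    have h5 : |h (x t) - h (gridVal N u x (i + 1))| ≤ K * gridOsc N u x := by
      have := hh.dist_le_mul (x t) (gridVal N u x (i + 1))
      rw [Real.dist_eq, Real.dist_eq] at this
      refine this.trans (mul_le_mul_of_nonneg_left ?_ K.2)
      refine le_trans ?_ (gridInc_le_gridOsc hi')
      rw [abs_sub_comm, abs_of_nonneg (sub_nonneg.2 h4), gridInc]
      linarith
    calc w i * |h (x t) - c i|
        ≤ w i * (|h (x t) - h (gridVal N u x (i + 1))| + |h (gridVal N u x (i + 1)) - c i|) :=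
          mul_le_mul_of_nonneg_left (abs_sub_le _ _ _) (hw0 i)
      _ ≤ w i * (K * gridOsc N u x) + 1 * |h (gridVal N u x (i + 1)) - c i| := by
          rw [mul_add]
          exact add_le_add (mul_le_mul_of_nonneg_left h5 (hw0 i))
            (mul_le_mul_of_nonneg_right (hw1 i) (abs_nonneg _))
      _ = _ := by rw [one_mul]

/-- The Riemann-Stieltjes sums of `h` along a cdf approximate `∫ r in 0..1, h r`. -/
theorem abs_integral_sub_sum_le (hm : Monotone x) (hu : Monotone u)
    {h : ℝ → ℝ} {K : NNReal} (hh : LipschitzWith K h) :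
    |(∫ r in (0 : ℝ)..1, h r) - ∑ i ∈ Finset.range (N + 1),
      h (gridVal N u x (i + 1)) * gridInc N u x i| ≤ K * gridOsc N u x := by
  have hint : ∀ a b, IntervalIntegrable h volume a b := fun a b =>
    hh.continuous.intervalIntegrable a b
  have h0 : ∫ r in (0 : ℝ)..1, h r = ∑ i ∈ Finset.range (N + 1),
      ∫ r in (gridVal N u x i)..(gridVal N u x (i + 1)), h r := by
    rw [intervalIntegral.sum_integral_adjacent_intervals fun _ _ => hint _ _]
    simp [gridVal]
  have h2 : (K : ℝ) * gridOsc N u x =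
      ∑ i ∈ Finset.range (N + 1), K * gridOsc N u x * gridInc N u x i := by
    rw [← Finset.mul_sum, sum_gridInc, mul_one]
  rw [h0, h2, ← Finset.sum_sub_distrib]
  refine (Finset.abs_sum_le_sum_abs _ _).trans (Finset.sum_le_sum fun i hi => ?_)
  have hi' := Finset.mem_range.1 hi
  have hle := sub_nonneg.1 (gridInc_nonneg (N := N) hm hu i)
  have h3 : h (gridVal N u x (i + 1)) * gridInc N u x i =
      ∫ r in (gridVal N u x i)..(gridVal N u x (i + 1)), h (gridVal N u x (i + 1)) := by
    rw [intervalIntegral.integral_const, smul_eq_mul, mul_comm, gridInc]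
  rw [h3, ← intervalIntegral.integral_sub (hint _ _) (by simp)]
  have h4 := intervalIntegral.norm_integral_le_of_norm_le_const (a := gridVal N u x i)
    (b := gridVal N u x (i + 1)) (C := K * gridOsc N u x)
    (f := fun r => h r - h (gridVal N u x (i + 1))) (fun r hr => by
      rw [uIoc_of_le hle] at hr
      have := hh.dist_le_mul r (gridVal N u x (i + 1))
      rw [dist_eq_norm, Real.dist_eq] at this
      refine this.trans (mul_le_mul_of_nonneg_left ?_ K.2)
      refine le_trans ?_ (gridInc_le_gridOsc hi')
      rw [abs_sub_comm, abs_of_nonneg (sub_nonneg.2 hr.2), gridInc]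
      linarith [hr.1])
  rwa [abs_of_nonneg (sub_nonneg.2 hle), Real.norm_eq_abs] at h4

/-- The grid of mesh `1 / (m + 1)` on `[-m, m]`. -/
noncomputable def grid (m i : ℕ) : ℝ := -m + i / (m + 1)

theorem monotone_grid (m : ℕ) : Monotone (grid m) := by
  intro i j hij
  have : (i : ℝ) ≤ j := by exact_mod_cast hij
  unfold grid
  gcongr

/-- The oscillation of a continuous cdf along the grids tends to zero. -/
theorem tendsto_gridOsc (hm : Monotone x) (h0 : Tendsto x atBot (𝓝 0))
    (h1 : Tendsto x atTop (𝓝 1)) (hc : Continuous x) :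
    Tendsto (fun m : ℕ => gridOsc (2 * m * (m + 1) + 1) (grid m) x) atTop (𝓝 0) := by
  have hmem : ∀ v, x v ∈ Icc (0 : ℝ) 1 := fun v =>
    ⟨hm.le_of_tendsto h0 v, hm.ge_of_tendsto h1 v⟩
  rw [Metric.tendsto_atTop]
  intro ε hε
  obtain ⟨a, ha⟩ := eventually_atBot.1 (h0.eventually (gt_mem_nhds hε))
  obtain ⟨b, hb⟩ := eventually_atTop.1 (h1.eventually (lt_mem_nhds (show 1 - ε < 1 by linarith)))
  obtain ⟨M, hM⟩ := exists_nat_ge (max |a| |b|)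
  have hMa : x (-M) < ε := ha _ (by
    have := neg_abs_le a
    have := (le_max_left _ _).trans hM
    linarith)
  have hMb : 1 - ε < x M := hb _ (by
    have := le_abs_self b
    have := (le_max_right _ _).trans hM
    linarith)
  obtain ⟨δ, hδ, hδ'⟩ := Metric.uniformContinuousOn_iff.1
    ((isCompact_Icc (a := -(M : ℝ) - 1) (b := M + 1)).uniformContinuousOn_of_continuous
      hc.continuousOn) ε hε
  obtain ⟨n, hn⟩ := exists_nat_one_div_lt hδ
  refine ⟨max n M, fun m hmn => ?_⟩
  have hm1 : (n : ℝ) ≤ m := by exact_mod_cast (le_max_left _ _).trans hmn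
  have hm2 : (M : ℝ) ≤ m := by exact_mod_cast (le_max_right _ _).trans hmn
  have hmpos : (0 : ℝ) < m + 1 := by positivity
  have hmesh : (1 : ℝ) / (m + 1) < δ :=
    (one_div_le_one_div_of_le (by positivity) (by linarith)).trans_lt hn
  have hmesh1 : (1 : ℝ) / (m + 1) ≤ 1 := by
    rw [div_le_one hmpos]; linarith [(Nat.cast_nonneg m : (0 : ℝ) ≤ m)]
  rw [Real.dist_eq, sub_zero, abs_of_nonneg (gridOsc_nonneg hm (monotone_grid m)), gridOsc,
    Finset.sup'_lt_iff]
  intro i hi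
  have hi' := Finset.mem_range.1 hi
  rw [gridInc]
  cases i with
  | zero =>
    rw [gridVal, gridVal, if_pos (by omega), clamp_eq_self (hmem _), sub_zero]
    refine (hm ?_).trans_lt hMa
    simp [grid, hm2]
  | succ i =>
    rw [gridVal, gridVal, if_pos (show i < _ by omega)]
    simp only [clamp_eq_self (hmem _)]
    split_ifs with hlt
    · have hstep : grid m (i + 1) = grid m i + 1 / (m + 1) := by
        unfold grid; push_cast; ring
      have hs0 : (0 : ℝ) < 1 / (m + 1) := by positivity
      rcases le_or_gt (grid m (i + 1)) (-M) with hA | hA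
      · linarith [hm hA, (hmem (grid m i)).1]
      rcases le_or_gt (M : ℝ) (grid m i) with hB | hB
      · linarith [hm hB, (hmem (grid m (i + 1))).2]
      have := hδ' (grid m (i + 1)) ⟨by linarith, by linarith⟩ (grid m i)
        ⟨by linarith, by linarith⟩ (by
          rw [Real.dist_eq, hstep, add_sub_cancel_left, abs_of_pos hs0]; exact hmesh)
      rw [Real.dist_eq] at this
      exact (le_abs_self _).trans_lt this
    · have hi2 : i = 2 * m * (m + 1) := by omega
      have hg : grid m i = m := by
        rw [grid, hi2]; push_cast; field_simp; ring
      rw [hg]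
      linarith [hm hm2]

end Grid

open scoped BoundedContinuousFunction

section Functionals

variable {S : Type*} [TopologicalSpace S]

/-- The functional approximating the expectation of `h` of the p-value, where `g i` stands for the
value of `h` on the `i`-th cell of the grid. -/
noncomputable def cellSum (N : ℕ) (u : ℕ → ℝ) (g : ℕ → S →ᵇ ℝ) (z : Cadlag × Cadlag × S) : ℝ :=
  ∑ i ∈ Finset.range (N + 1), g i z.2.2 * gridInc N u z.1 i

/-- A bound on the error of the approximation by `cellSum`. -/
noncomputable def cellError (N : ℕ) (u : ℕ → ℝ) (h : ℝ → ℝ) (K : NNReal) (g : ℕ → S →ᵇ ℝ)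
    (z : Cadlag × Cadlag × S) : ℝ :=
  K * gridOsc N u z.2.1 +
    ∑ i ∈ Finset.range (N + 1), |h (gridVal N u z.2.1 (i + 1)) - g i z.2.2|

variable {N : ℕ} {u : ℕ → ℝ} {h : ℝ → ℝ} {K : NNReal} {g : ℕ → S →ᵇ ℝ}

theorem exists_abs_cellSum_le : ∃ C, ∀ z, |cellSum N u g z| ≤ C := by
  refine ⟨∑ i ∈ Finset.range (N + 1), ‖g i‖, fun z => ?_⟩
  refine (Finset.abs_sum_le_sum_abs _ _).trans (Finset.sum_le_sum fun i _ => ?_)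
  rw [abs_mul]
  exact (mul_le_of_le_one_right (abs_nonneg _) (abs_gridInc_le i)).trans ((g i).norm_coe_le_norm _)

theorem exists_abs_cellError_le (hb : ∃ C, ∀ r, |h r| ≤ C) :
    ∃ C, ∀ z, |cellError N u h K g z| ≤ C := by
  obtain ⟨C, hC⟩ := hb
  refine ⟨K + ∑ i ∈ Finset.range (N + 1), (C + ‖g i‖), fun z => ?_⟩
  refine (abs_add_le _ _).trans (add_le_add ?_ ?_)
  · rw [abs_mul, NNReal.abs_eq]
    exact mul_le_of_le_one_right K.2 abs_gridOsc_le
  · refine (Finset.abs_sum_le_sum_abs _ _).trans (Finset.sum_le_sum fun i _ => ?_)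
    rw [abs_abs]
    exact (abs_sub _ _).trans (add_le_add (hC _) ((g i).norm_coe_le_norm _))

theorem continuousAt_cellSum {z : Cadlag × Cadlag × S} (h1 : Continuous z.1) :
    ContinuousAt (cellSum N u g) z := by
  refine tendsto_finsetSum _ fun i _ => ContinuousAt.mul (by fun_prop) ?_
  exact continuousAt_gridInc (x := fun z : Cadlag × Cadlag × S => z.1) (fun t =>
    (Cadlag.continuousAt_eval h1.continuousAt).comp (f := Prod.fst) continuousAt_fst) i

theorem continuousAt_cellError {z : Cadlag × Cadlag × S} (h2 : Continuous z.2.1)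
    (hh : Continuous h) : ContinuousAt (cellError N u h K g) z := by
  have hev : ∀ t, ContinuousAt (fun z : Cadlag × Cadlag × S => z.2.1 t) z := fun t =>
    (Cadlag.continuousAt_eval h2.continuousAt).comp (f := fun z : Cadlag × Cadlag × S => z.2.1)
      (by fun_prop)
  refine ContinuousAt.add (continuousAt_const.mul
    (continuousAt_gridOsc (x := fun z : Cadlag × Cadlag × S => z.2.1) hev)) ?_
  refine tendsto_finsetSum _ fun i _ => ContinuousAt.abs (ContinuousAt.sub ?_ (by fun_prop))
  exact hh.continuousAt.comp
    (continuousAt_gridVal (x := fun z : Cadlag × Cadlag × S => z.2.1) hev _)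

variable [MeasurableSpace S] [BorelSpace S] {Ω : Type*} [MeasurableSpace Ω] {P : Measure Ω}
  {Z : Ω → Cadlag × Cadlag × S}

theorem aemeasurable_cellSum (h1 : ∀ t, AEMeasurable (fun ω => (Z ω).1 t) P)
    (h3 : AEMeasurable (fun ω => (Z ω).2.2) P) :
    AEMeasurable (fun ω => cellSum N u g (Z ω)) P :=
  Finset.aemeasurable_fun_sum _ fun i _ =>
    ((g i).continuous.measurable.comp_aemeasurable h3).mul
      (aemeasurable_gridInc (x := fun ω => (Z ω).1) h1 i)

theorem aemeasurable_cellError (h2 : ∀ t, AEMeasurable (fun ω => (Z ω).2.1 t) P)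
    (h3 : AEMeasurable (fun ω => (Z ω).2.2) P) (hh : Continuous h) :
    AEMeasurable (fun ω => cellError N u h K g (Z ω)) P :=
  (aemeasurable_const.mul (aemeasurable_gridOsc (x := fun ω => (Z ω).2.1) h2)).add <|
  Finset.aemeasurable_fun_sum _ fun i _ => by
    have := (hh.measurable.comp_aemeasurable
      (aemeasurable_gridVal (N := N) (u := u) (x := fun ω => (Z ω).2.1) h2 (i + 1))).sub
      ((g i).continuous.measurable.comp_aemeasurable h3)
    exact continuous_abs.measurable.comp_aemeasurable this

end Functionals

theorem integrable_of_abs_le {Ω : Type*} [MeasurableSpace Ω] {P : Measure Ω} [IsFiniteMeasure P]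
    {f : Ω → ℝ} (hf : AEMeasurable f P) (hb : ∃ C, ∀ ω, |f ω| ≤ C) : Integrable f P := by
  obtain ⟨C, hC⟩ := hb
  exact Integrable.of_bound hf.aestronglyMeasurable C (Eventually.of_forall hC)

theorem abs_integral_sub_le {Ω : Type*} [MeasurableSpace Ω] {P : Measure Ω} {f g e : Ω → ℝ}
    (hf : Integrable f P) (hg : Integrable g P) (he : Integrable e P)
    (h : ∀ᵐ ω ∂P, |f ω - g ω| ≤ e ω) : |(∫ ω, f ω ∂P) - ∫ ω, g ω ∂P| ≤ ∫ ω, e ω ∂P := by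
  rw [← integral_sub hf hg]
  exact (abs_integral_le_integral_abs).trans (integral_mono_ae (hf.sub hg).abs he h)

/-- Replacing a random function by its conditional expectation inside a grid increment. -/
theorem integral_mul_gridInc_eq {Ω : Type*} {m mΩ : MeasurableSpace Ω} {P : Measure Ω}
    [IsFiniteMeasure P] (hm : m ≤ mΩ) {f : Ω → ℝ} (hf : AEStronglyMeasurable[m] f P)
    (hb : ∃ C, ∀ ω, |f ω| ≤ C) {x y : Ω → ℝ → ℝ}
    (hx : ∀ t, AEMeasurable (fun ω => x ω t) P) (hy : ∀ t, AEMeasurable (fun ω => y ω t) P)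
    (hx1 : ∀ t, ∀ᵐ ω ∂P, x ω t ∈ Icc (0 : ℝ) 1) (hy1 : ∀ t, ∀ᵐ ω ∂P, y ω t ∈ Icc (0 : ℝ) 1)
    (hxy : ∀ t, P[fun ω => x ω t | m] =ᵐ[P] fun ω => y ω t) (N : ℕ) (u : ℕ → ℝ) (i : ℕ) :
    ∫ ω, f ω * gridInc N u (x ω) i ∂P = ∫ ω, f ω * gridInc N u (y ω) i ∂P := by
  have hf' : AEMeasurable f P := (hf.mono hm).aemeasurable
  have hint : ∀ {x : Ω → ℝ → ℝ}, (∀ t, AEMeasurable (fun ω => x ω t) P) → ∀ j,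
      Integrable (fun ω => f ω * gridVal N u (x ω) j) P := fun hx j => by
    obtain ⟨C, hC⟩ := hb
    refine integrable_of_abs_le (hf'.mul (aemeasurable_gridVal hx j)) ⟨C, fun ω => ?_⟩
    rw [abs_mul]
    refine (mul_le_of_le_one_right (abs_nonneg _) ?_).trans (hC ω)
    rw [abs_of_nonneg (gridVal_mem _).1]
    exact (gridVal_mem _).2
  have key : ∀ j, ∫ ω, f ω * gridVal N u (x ω) j ∂P = ∫ ω, f ω * gridVal N u (y ω) j ∂P := by
    intro j
    cases j with
    | zero => rfl
    | succ j =>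
      have hix := hint hx (j + 1)
      have hiy := hint hy (j + 1)
      simp only [gridVal] at hix hiy ⊢
      split_ifs with hj
      · have ex : ∀ᵐ ω ∂P, f ω * clamp (x ω (u j)) = f ω * x ω (u j) := by
          filter_upwards [hx1 (u j)] with ω hω using by rw [clamp_eq_self hω]
        have ey : ∀ᵐ ω ∂P, f ω * clamp (y ω (u j)) = f ω * y ω (u j) := by
          filter_upwards [hy1 (u j)] with ω hω using by rw [clamp_eq_self hω]
        simp only [if_pos hj] at hix hiy
        have hxi : Integrable (fun ω => x ω (u j)) P := by
          refine Integrable.of_bound (hx (u j)).aestronglyMeasurable 1 ?_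
          filter_upwards [hx1 (u j)] with ω hω
          rw [Real.norm_eq_abs, abs_of_nonneg hω.1]
          exact hω.2
        rw [integral_congr_ae ex, integral_congr_ae ey]
        have h1 := condExp_mul_of_aestronglyMeasurable_left (m := m) hf
          ((integrable_congr ex).1 hix) hxi
        have h2 : ∫ ω, (P[f * fun ω => x ω (u j) | m]) ω ∂P = ∫ ω, f ω * x ω (u j) ∂P :=
          integral_condExp hm
        rw [← h2, integral_congr_ae h1]
        refine integral_congr_ae ?_
        filter_upwards [hxy (u j)] with ω hω
        rw [Pi.mul_apply, hω]
      · rfl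
  simp only [gridInc, mul_sub]
  rw [integral_sub (hint hx _) (hint hx _), integral_sub (hint hy _) (hint hy _), key, key]

section CondCdf

variable {Ω S : Type*} [MeasurableSpace Ω] [MeasurableSpace S] {P : Measure Ω}
  [IsProbabilityMeasure P]

theorem randomCondCdf_apply (Y : Ω → ℝ) (X : Ω → S) (ω : Ω) (t : ℝ) :
    randomCondCdf P Y X ω t = (condDistrib Y X P (X ω)).real (Iic t) :=
  cdf_eq_real _ t

theorem randomCondCdf_mem (Y : Ω → ℝ) (X : Ω → S) (ω : Ω) (t : ℝ) :
    randomCondCdf P Y X ω t ∈ Icc (0 : ℝ) 1 := ⟨cdf_nonneg _ _, cdf_le_one _ _⟩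

theorem monotone_randomCondCdf (Y : Ω → ℝ) (X : Ω → S) (ω : Ω) :
    Monotone (randomCondCdf P Y X ω) := monotone_cdf _

theorem measurable_randomCondCdf (Y : Ω → ℝ) {X : Ω → S} (hX : Measurable X) (t : ℝ) :
    Measurable fun ω => randomCondCdf P Y X ω t := by
  simp_rw [randomCondCdf_apply]
  exact ((Kernel.measurable_coe _ measurableSet_Iic).comp hX).ennreal_toReal

theorem condExp_step_ae_eq {Y : Ω → ℝ} {X : Ω → S} (hY : Measurable Y) (hX : Measurable X)
    (t : ℝ) : P[fun ω => step (Y ω) t | MeasurableSpace.comap X inferInstance] =ᵐ[P]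
      fun ω => randomCondCdf P Y X ω t := by
  have h := condDistrib_ae_eq_condExp (μ := P) hX hY (measurableSet_Iic (a := t))
  have h1 : (fun ω => step (Y ω) t) = (Y ⁻¹' Iic t).indicator fun _ => (1 : ℝ) := by
    ext ω
    simp [step, indicator]
  rw [h1]
  refine h.symm.trans (Eventually.of_forall fun ω => (randomCondCdf_apply Y X ω t).symm)

theorem bootstrapPValue_ae_eq {D : Ω → S} (hD : Measurable D) {τ : S → ℝ} (hτ : Measurable τ)
    {τs : Ω → ℝ} (hτs : Measurable τs) :
    bootstrapPValue P D (fun ω => τ (D ω)) τs =ᵐ[P]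
      fun ω => randomCondCdf P τs D ω (τ (D ω)) := by
  have hA : MeasurableSet {p : S × ℝ | p.2 ≤ τ p.1} :=
    measurableSet_le measurable_snd (hτ.comp measurable_fst)
  have h := condExp_prod_ae_eq_integral_condDistrib (μ := P) hD hτs.aemeasurable
    (f := {p : S × ℝ | p.2 ≤ τ p.1}.indicator fun _ => (1 : ℝ))
    (stronglyMeasurable_const.indicator hA)
    ((integrable_const (1 : ℝ)).indicator ((hD.prodMk hτs) hA))
  refine h.trans (Eventually.of_forall fun ω => ?_)
  simp only [randomCondCdf_apply]
  have h1 : (fun y => {p : S × ℝ | p.2 ≤ τ p.1}.indicator (fun _ => (1 : ℝ)) (D ω, y)) =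
      (Iic (τ (D ω))).indicator 1 := by
    ext y
    simp [indicator]
  rw [h1, integral_indicator_one measurableSet_Iic]

end CondCdf

section PValue

variable {Ω SD SX S : Type*} [MeasurableSpace Ω] [MeasurableSpace SD] [MeasurableSpace SX]
  [TopologicalSpace S] [MeasurableSpace S] [BorelSpace S] {P : Measure Ω}

theorem measurable_bootstrapPValue {D : Ω → SD} (hD : Measurable D) (τ τs : Ω → ℝ) :
    Measurable (bootstrapPValue P D τ τs) :=
  (stronglyMeasurable_condExp.mono hD.comap_le).measurable

theorem abs_integral_pValue_sub_le [IsProbabilityMeasure P] {D : Ω → SD} (hD : Measurable D) {τ : SD → ℝ}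
    (hτ : Measurable τ) {τs : Ω → ℝ} (hτs : Measurable τs) {X : Ω → SX} (hX : Measurable X)
    {X' : Ω → S} (hX' : Measurable[MeasurableSpace.comap X inferInstance] X')
    {h : ℝ → ℝ} {K : NNReal} (hh : LipschitzWith K h) (hb : ∃ C, ∀ r, |h r| ≤ C)
    {N : ℕ} {u : ℕ → ℝ} (hu : Monotone u) (g : ℕ → S →ᵇ ℝ) :
    |(∫ ω, h (bootstrapPValue P D (fun ω => τ (D ω)) τs ω) ∂P) -
        ∫ ω, cellSum N u g (randomCondCdf P (fun ω => τ (D ω)) X ω,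
          randomCondCdf P τs D ω, X' ω) ∂P| ≤
      ∫ ω, cellError N u h K g (randomCondCdf P (fun ω => τ (D ω)) X ω,
          randomCondCdf P τs D ω, X' ω) ∂P := by
  have hT : Measurable fun ω => τ (D ω) := hτ.comp hD
  have hX'm : Measurable X' := hX'.mono hX.comap_le le_rfl
  have hstep : ∀ t, Measurable fun ω => step (τ (D ω)) t := fun t =>
    Measurable.ite (measurableSet_le hT measurable_const) measurable_const measurable_const
  have hG := measurable_randomCondCdf (P := P) (fun ω => τ (D ω)) hX
  have hGs := measurable_randomCondCdf (P := P) τs hD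
  have hgi : ∀ i, Measurable fun ω => g i (X' ω) := fun i =>
    (g i).continuous.measurable.comp hX'm
  have hint : ∀ {x : Ω → ℝ → ℝ}, (∀ t, Measurable fun ω => x ω t) → ∀ i,
      Integrable (fun ω => g i (X' ω) * gridInc N u (x ω) i) P := fun hx i => by
    refine integrable_of_abs_le ((hgi i).aemeasurable.mul
      (aemeasurable_gridInc (fun t => (hx t).aemeasurable) i)) ⟨‖g i‖, fun ω => ?_⟩
    rw [abs_mul]
    exact (mul_le_of_le_one_right (abs_nonneg _) (abs_gridInc_le i)).trans
      ((g i).norm_coe_le_norm _)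
  have hsum : ∫ ω, cellSum N u g (randomCondCdf P (fun ω => τ (D ω)) X ω,
      randomCondCdf P τs D ω, X' ω) ∂P =
      ∫ ω, ∑ i ∈ Finset.range (N + 1), g i (X' ω) * gridInc N u (step (τ (D ω))) i ∂P := by
    unfold cellSum
    rw [integral_finsetSum _ fun i _ => hint hG i, integral_finsetSum _ fun i _ => hint hstep i]
    refine Finset.sum_congr rfl fun i _ => ?_
    refine (integral_mul_gridInc_eq hX.comap_le ?_ ⟨‖g i‖, fun ω => (g i).norm_coe_le_norm _⟩
      (fun t => (hstep t).aemeasurable) (fun t => (hG t).aemeasurable) ?_ ?_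
      (condExp_step_ae_eq hT hX) N u i).symm
    · exact ((g i).continuous.measurable.comp hX').stronglyMeasurable.aestronglyMeasurable
    · exact fun t => Eventually.of_forall fun ω => by unfold step; split_ifs <;> simp
    · exact fun t => Eventually.of_forall fun ω => randomCondCdf_mem _ _ _ _
  rw [hsum]
  refine abs_integral_sub_le ?_ (integrable_finsetSum _ fun i _ => hint hstep i) ?_ ?_
  · obtain ⟨C, hC⟩ := hb
    exact integrable_of_abs_le (hh.continuous.measurable.comp
      (measurable_bootstrapPValue hD _ _)).aemeasurable ⟨C, fun ω => hC _⟩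
  · obtain ⟨C, hC⟩ := exists_abs_cellError_le (S := S) (N := N) (u := u) (K := K) (g := g) hb
    exact integrable_of_abs_le (aemeasurable_cellError (fun t => (hGs t).aemeasurable)
      hX'm.aemeasurable hh.continuous) ⟨C, fun ω => hC _⟩
  · filter_upwards [bootstrapPValue_ae_eq hD hτ hτs] with ω hω
    rw [hω]
    exact abs_sub_sum_step_le (randomCondCdf_mem τs D ω) (monotone_randomCondCdf τs D ω) hu hh
      (fun i => g i (X' ω)) (τ (D ω))

end PValue

section Limit

variable {Ω S : Type*} [MeasurableSpace Ω] {Q : Measure Ω}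
  {F Fs : Ω → Cadlag}

theorem IsContinuousRandomCdf.ae_mem (hF : IsContinuousRandomCdf Q F) (t : ℝ) :
    ∀ᵐ ω ∂Q, F ω t ∈ Icc (0 : ℝ) 1 := by
  filter_upwards [hF.2] with ω hω
  exact ⟨hω.1.1.le_of_tendsto hω.1.2.1 t, hω.1.1.ge_of_tendsto hω.1.2.2 t⟩

theorem IsContinuousRandomCdf.aemeasurable (hF : IsContinuousRandomCdf Q F) (t : ℝ) :
    AEMeasurable (fun ω => F ω t) Q := by
  obtain ⟨φ, hφ, h⟩ := exists_measurable_comp_ae_eq (φ := fun x : Cadlag => x t)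
    hF.1.aemeasurable (hF.2.mono fun ω hω => Cadlag.continuousAt_eval hω.2.continuousAt)
  exact (hφ.comp hF.1).aemeasurable.congr (h.mono fun _ h => h.symm)

theorem IsContinuousRandomCdf.exists_measurable_comp_gridVal (hF : IsContinuousRandomCdf Q F)
    {h : ℝ → ℝ} (hh : Continuous h) (N : ℕ) (u : ℕ → ℝ) (i : ℕ) :
    ∃ φ : Cadlag → ℝ, Measurable φ ∧ ∀ᵐ ω ∂Q, h (gridVal N u (F ω) i) = φ (F ω) :=
  exists_measurable_comp_ae_eq (φ := fun x : Cadlag => h (gridVal N u x i))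
    hF.1.aemeasurable (hF.2.mono fun _ hω => hh.continuousAt.comp
      (continuousAt_gridVal (x := fun x : Cadlag => x)
        (fun _ => Cadlag.continuousAt_eval hω.2.continuousAt) i))

variable [IsProbabilityMeasure Q] [TopologicalSpace S] [MeasurableSpace S] [BorelSpace S]
  {XL : Ω → S}
  {h : ℝ → ℝ} {K : NNReal}

theorem abs_integral_sub_integral_cellSum_le (hF : IsContinuousRandomCdf Q F)
    (hFs : IsContinuousRandomCdf Q Fs) (hXL : Measurable XL)
    (hE : ∀ t : ℝ,
      Q[fun ω => F ω t | MeasurableSpace.comap Fs inferInstance] =ᵐ[Q] fun ω => Fs ω t)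
    (hh : LipschitzWith K h) (hb : ∃ C, ∀ r, |h r| ≤ C)
    {N : ℕ} {u : ℕ → ℝ} (hu : Monotone u) (g : ℕ → S →ᵇ ℝ) :
    |(∫ r in (0 : ℝ)..1, h r) - ∫ ω, cellSum N u g (F ω, Fs ω, XL ω) ∂Q| ≤
      ∫ ω, cellError N u h K g (F ω, Fs ω, XL ω) ∂Q := by
  have hb' := hb
  obtain ⟨C, hC⟩ := hb'
  have hval : ∀ i, AEMeasurable (fun ω => h (gridVal N u (Fs ω) i)) Q := fun i =>
    hh.continuous.measurable.comp_aemeasurable (aemeasurable_gridVal hFs.aemeasurable i)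
  have hint : ∀ {x : Ω → ℝ → ℝ}, (∀ t, AEMeasurable (fun ω => x ω t) Q) → ∀ i,
      Integrable (fun ω => h (gridVal N u (Fs ω) (i + 1)) * gridInc N u (x ω) i) Q :=
    fun hx i => by
      refine integrable_of_abs_le ((hval _).mul (aemeasurable_gridInc hx i)) ⟨C, fun ω => ?_⟩
      rw [abs_mul]
      exact (mul_le_of_le_one_right (abs_nonneg _) (abs_gridInc_le i)).trans (hC _)
  have hsumint : ∀ {x : Ω → ℝ → ℝ}, (∀ t, AEMeasurable (fun ω => x ω t) Q) →
      Integrable (fun ω => ∑ i ∈ Finset.range (N + 1),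
        h (gridVal N u (Fs ω) (i + 1)) * gridInc N u (x ω) i) Q :=
    fun hx => integrable_finsetSum _ fun i _ => hint hx i
  have hosc : Integrable (fun ω => K * gridOsc N u (Fs ω)) Q :=
    (integrable_of_abs_le (aemeasurable_gridOsc hFs.aemeasurable)
      ⟨1, fun _ => abs_gridOsc_le⟩).const_mul _
  have hdiff : ∀ i, Integrable
      (fun ω => |h (gridVal N u (Fs ω) (i + 1)) - g i (XL ω)|) Q := fun i => by
    refine Integrable.abs (Integrable.sub (integrable_of_abs_le (hval _) ⟨C, fun _ => hC _⟩) ?_)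
    exact integrable_of_abs_le ((g i).continuous.measurable.comp hXL).aemeasurable
      ⟨‖g i‖, fun ω => (g i).norm_coe_le_norm _⟩
  have hdiffs := integrable_finsetSum (Finset.range (N + 1)) fun i _ => hdiff i
  have hswap : ∫ ω, ∑ i ∈ Finset.range (N + 1),
        h (gridVal N u (Fs ω) (i + 1)) * gridInc N u (F ω) i ∂Q =
      ∫ ω, ∑ i ∈ Finset.range (N + 1),
        h (gridVal N u (Fs ω) (i + 1)) * gridInc N u (Fs ω) i ∂Q := by
    rw [integral_finsetSum _ fun i _ => hint hF.aemeasurable i,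
      integral_finsetSum _ fun i _ => hint hFs.aemeasurable i]
    refine Finset.sum_congr rfl fun i _ => ?_
    obtain ⟨φ, hφ, hae⟩ := hFs.exists_measurable_comp_gridVal hh.continuous N u (i + 1)
    refine integral_mul_gridInc_eq hFs.1.comap_le ⟨_, ?_, hae⟩ ⟨C, fun ω => hC _⟩
      hF.aemeasurable hFs.aemeasurable hF.ae_mem hFs.ae_mem hE N u i
    exact (hφ.comp (comap_measurable Fs)).stronglyMeasurable
  have h1 : |(∫ r in (0 : ℝ)..1, h r) - ∫ ω, ∑ i ∈ Finset.range (N + 1),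
      h (gridVal N u (Fs ω) (i + 1)) * gridInc N u (Fs ω) i ∂Q| ≤
      ∫ ω, K * gridOsc N u (Fs ω) ∂Q := by
    have := abs_integral_sub_le (P := Q) (integrable_const (∫ r in (0 : ℝ)..1, h r))
      (hsumint hFs.aemeasurable) hosc
      (hFs.2.mono fun ω hω => abs_integral_sub_sum_le hω.1.1 hu hh)
    simpa using this
  have h2 : |(∫ ω, ∑ i ∈ Finset.range (N + 1),
        h (gridVal N u (Fs ω) (i + 1)) * gridInc N u (F ω) i ∂Q) -
      ∫ ω, cellSum N u g (F ω, Fs ω, XL ω) ∂Q| ≤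
      ∫ ω, ∑ i ∈ Finset.range (N + 1), |h (gridVal N u (Fs ω) (i + 1)) - g i (XL ω)| ∂Q := by
    obtain ⟨C', hC'⟩ := exists_abs_cellSum_le (S := S) (N := N) (u := u) (g := g)
    refine abs_integral_sub_le (hsumint hF.aemeasurable) (integrable_of_abs_le
      (aemeasurable_cellSum hF.aemeasurable hXL.aemeasurable) ⟨C', fun _ => hC' _⟩) hdiffs
      (Eventually.of_forall fun ω => ?_)
    rw [cellSum, ← Finset.sum_sub_distrib]
    refine (Finset.abs_sum_le_sum_abs _ _).trans (Finset.sum_le_sum fun i _ => ?_)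
    rw [← sub_mul, abs_mul]
    exact mul_le_of_le_one_right (abs_nonneg _) (abs_gridInc_le i)
  rw [hswap] at h2
  unfold cellError
  rw [integral_add hosc hdiffs]
  exact (abs_sub_le _ _ _).trans (add_le_add h1 h2)

theorem exists_integral_abs_sub_le [PolishSpace S] (hFs : IsContinuousRandomCdf Q Fs)
    (hXL : Measurable XL) (hFsXL : Measurable[MeasurableSpace.comap XL inferInstance] Fs)
    (hh : Continuous h) (hb : ∃ C, ∀ r, |h r| ≤ C) (N : ℕ) (u : ℕ → ℝ) (i : ℕ)
    {η : ℝ} (hη : 0 < η) :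
    ∃ g : S →ᵇ ℝ, ∫ ω, |h (gridVal N u (Fs ω) i) - g (XL ω)| ∂Q ≤ η := by
  obtain ⟨φ, hφ, hae⟩ := hFs.exists_measurable_comp_gridVal hh N u i
  have h1 : Measurable[MeasurableSpace.comap XL inferInstance] fun ω => φ (Fs ω) :=
    hφ.comp hFsXL
  obtain ⟨k, hk, hkeq⟩ := h1.exists_eq_measurable_comp
  have hae' : (fun ω => h (gridVal N u (Fs ω) i)) =ᵐ[Q] k ∘ XL := by
    rw [← hkeq]; exact hae
  have hint : Integrable (fun ω => h (gridVal N u (Fs ω) i)) Q := by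
    obtain ⟨C, hC⟩ := hb
    exact integrable_of_abs_le (hh.measurable.comp_aemeasurable
      (aemeasurable_gridVal hFs.aemeasurable i)) ⟨C, fun _ => hC _⟩
  have hki : Integrable k (Q.map XL) :=
    (integrable_map_measure hk.aestronglyMeasurable hXL.aemeasurable).2 (hint.congr hae')
  let _ := TopologicalSpace.upgradeIsCompletelyMetrizable S
  have : IsProbabilityMeasure (Q.map XL) := Measure.isProbabilityMeasure_map hXL.aemeasurable
  obtain ⟨g, hg, -⟩ := hki.exists_boundedContinuous_integral_sub_le hη
  refine ⟨g, le_trans (le_of_eq ?_) hg⟩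
  rw [integral_map hXL.aemeasurable
    (f := fun x => ‖k x - g x‖) (hk.sub g.continuous.measurable).norm.aestronglyMeasurable]
  refine integral_congr_ae ?_
  filter_upwards [hae'] with ω hω
  rw [hω, Real.norm_eq_abs, Function.comp_apply]

theorem exists_integral_cellError_le [PolishSpace S] (hFs : IsContinuousRandomCdf Q Fs)
    (hXL : Measurable XL) (hFsXL : Measurable[MeasurableSpace.comap XL inferInstance] Fs)
    (hh : LipschitzWith K h) (hb : ∃ C, ∀ r, |h r| ≤ C) {η : ℝ} (hη : 0 < η) :
    ∃ (N : ℕ) (u : ℕ → ℝ) (g : ℕ → S →ᵇ ℝ), Monotone u ∧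
      ∫ ω, cellError N u h K g (F ω, Fs ω, XL ω) ∂Q ≤ η := by
  have hosc : ∀ N u, AEMeasurable (fun ω => gridOsc N u (Fs ω)) Q := fun N u =>
    aemeasurable_gridOsc hFs.aemeasurable
  have hlim : Tendsto (fun m : ℕ => K * ∫ ω, gridOsc (2 * m * (m + 1) + 1) (grid m) (Fs ω) ∂Q)
      atTop (𝓝 0) := by
    have h1 : Tendsto (fun m : ℕ => ∫ ω, gridOsc (2 * m * (m + 1) + 1) (grid m) (Fs ω) ∂Q)
        atTop (𝓝 (∫ _, (0 : ℝ) ∂Q)) :=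
      tendsto_integral_of_dominated_convergence (fun _ => 1)
        (fun m => (hosc _ _).aestronglyMeasurable) (integrable_const _)
        (fun m => Eventually.of_forall fun ω => abs_gridOsc_le)
        (hFs.2.mono fun ω hω => tendsto_gridOsc hω.1.1 hω.1.2.1 hω.1.2.2 hω.2)
    simpa using h1.const_mul (K : ℝ)
  obtain ⟨m, hm⟩ := (hlim.eventually (gt_mem_nhds (half_pos hη))).exists
  set N := 2 * m * (m + 1) + 1
  have hη' : 0 < η / 2 / (N + 1) := by positivity
  choose g hg using fun i => exists_integral_abs_sub_le hFs hXL hFsXL hh.continuous hb N (grid m)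
    (i + 1) hη'
  refine ⟨N, grid m, g, monotone_grid m, ?_⟩
  have hdiff : ∀ i, Integrable
      (fun ω => |h (gridVal N (grid m) (Fs ω) (i + 1)) - g i (XL ω)|) Q := fun i => by
    obtain ⟨C, hC⟩ := hb
    refine Integrable.abs (Integrable.sub (integrable_of_abs_le
      (hh.continuous.measurable.comp_aemeasurable (aemeasurable_gridVal hFs.aemeasurable _))
      ⟨C, fun _ => hC _⟩) ?_)
    exact integrable_of_abs_le ((g i).continuous.measurable.comp hXL).aemeasurable
      ⟨‖g i‖, fun ω => (g i).norm_coe_le_norm _⟩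
  unfold cellError
  rw [integral_add ((integrable_of_abs_le (hosc _ _) ⟨1, fun _ => abs_gridOsc_le⟩).const_mul _)
    (integrable_finsetSum _ fun i _ => hdiff i), integral_const_mul,
    integral_finsetSum _ fun i _ => hdiff i]
  have hsum : ∑ i ∈ Finset.range (N + 1),
      ∫ ω, |h (gridVal N (grid m) (Fs ω) (i + 1)) - g i (XL ω)| ∂Q ≤ η / 2 := by
    refine (Finset.sum_le_sum fun i _ => hg i).trans (le_of_eq ?_)
    rw [Finset.sum_const, Finset.card_range, nsmul_eq_mul]
    push_cast
    field_simp
  linarith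

end Limit

/-- A criterion for unconditional validity in terms of Lipschitz test functions. -/
theorem unconditionallyValid_of_tendsto_integral {Ω S : ℕ → Type*} [∀ n, MeasurableSpace (Ω n)]
    [∀ n, MeasurableSpace (S n)] {P : ∀ n, Measure (Ω n)} [∀ n, IsProbabilityMeasure (P n)]
    {D : ∀ n, Ω n → S n} (hD : ∀ n, Measurable (D n)) {τ τs : ∀ n, Ω n → ℝ}
    (H : ∀ (h : ℝ → ℝ) (K : NNReal), LipschitzWith K h → (∃ C, ∀ r, |h r| ≤ C) →
      Tendsto (fun n => ∫ ω, h (bootstrapPValue (P n) (D n) (τ n) (τs n) ω) ∂P n) atTop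
        (𝓝 (∫ r in (0 : ℝ)..1, h r))) :
    UnconditionallyValid P D τ τs := by
  intro q hq
  have hp := fun n => measurable_bootstrapPValue (P := P n) (hD n) (τ n) (τs n)
  let μs : ℕ → ProbabilityMeasure ℝ := fun n =>
    ⟨(P n).map (bootstrapPValue (P n) (D n) (τ n) (τs n)),
      Measure.isProbabilityMeasure_map (hp n).aemeasurable⟩
  let μ : ProbabilityMeasure ℝ := ⟨volume.restrict (Ioc (0 : ℝ) 1), ⟨by simp⟩⟩
  have hconv : Tendsto μs atTop (𝓝 μ) := by
    rw [tendsto_iff_forall_lipschitz_integral_tendsto]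
    rintro f ⟨C, hC⟩ ⟨K, hK⟩
    have h1 := H f K hK ⟨|f 0| + C, fun r => by
      have h2 := hC r 0
      rw [Real.dist_eq] at h2
      have h3 := abs_sub_abs_le_abs_sub (f r) (f 0)
      linarith⟩
    rw [intervalIntegral.integral_of_le zero_le_one] at h1
    refine h1.congr fun n => ?_
    exact (integral_map (hp n).aemeasurable hK.continuous.aestronglyMeasurable).symm
  have hfr : (μ : Measure ℝ) (frontier (Iic q)) = 0 := by
    rw [frontier_Iic]
    exact measure_singleton (μ := volume.restrict (Ioc (0 : ℝ) 1)) q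
  have h1 := ProbabilityMeasure.tendsto_measure_of_null_frontier_of_tendsto' hconv hfr
  have h2 : (μ : Measure ℝ) (Iic q) = ENNReal.ofReal q := by
    change volume.restrict (Ioc (0 : ℝ) 1) (Iic q) = _
    rw [Measure.restrict_apply measurableSet_Iic, inter_comm, Ioc_inter_Iic,
      min_eq_right hq.2.le, Real.volume_Ioc, sub_zero]
  rw [h2] at h1
  have h3 := (ENNReal.tendsto_toReal ENNReal.ofReal_ne_top).comp h1
  rw [ENNReal.toReal_ofReal hq.1.le] at h3
  refine h3.congr fun n => ?_
  change ((P n).map _ (Iic q)).toReal = _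
  rw [Measure.map_apply (hp n) measurableSet_Iic]
  rfl

end RandomLimitBootstrap

theorem theoremp2
    -- the probability spaces, the data `D n` and the auxiliary variates `W n`
    {Ω SD SW SX : ℕ → Type*}
    [∀ n, MeasurableSpace (Ω n)]
    [∀ n, MeasurableSpace (SD n)] [∀ n, StandardBorelSpace (SD n)]
    [∀ n, MeasurableSpace (SW n)] [∀ n, StandardBorelSpace (SW n)]
    [∀ n, MeasurableSpace (SX n)] [∀ n, StandardBorelSpace (SX n)]
    (P : ∀ n, Measure (Ω n)) [∀ n, IsProbabilityMeasure (P n)]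
    (D : ∀ n, Ω n → SD n) (hD : ∀ n, Measurable (D n))
    (W : ∀ n, Ω n → SW n) (hW : ∀ n, Measurable (W n))
    -- the original statistic `τ n (D n)` and the bootstrap statistic `τs n (D n, W n)`
    (τ : ∀ n, SD n → ℝ) (hτ : ∀ n, Measurable (τ n))
    (τs : ∀ n, SD n × SW n → ℝ) (hτs : ∀ n, Measurable (τs n))
    -- the conditioning elements `X n`, measurable with respect to `D n`
    (X : ∀ n, Ω n → SX n)
    (hX : ∀ n, Measurable[MeasurableSpace.comap (D n) inferInstance] (X n))
    -- the probability space of the limits, and the limiting random cdfs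
    {Ω' : Type*} [MeasurableSpace Ω'] (Q : Measure Ω') [IsProbabilityMeasure Q]
    (F Fs : Ω' → RandomLimitBootstrap.Cadlag)
    (hF : RandomLimitBootstrap.IsContinuousRandomCdf Q F)
    (hFs : RandomLimitBootstrap.IsContinuousRandomCdf Q Fs)
    -- the random elements `X' n` and their limit `XL`, in a common Polish space
    {S' : Type*} [TopologicalSpace S'] [PolishSpace S'] [MeasurableSpace S'] [BorelSpace S']
    (X' : ∀ n, Ω n → S')
    (hX' : ∀ n, Measurable[MeasurableSpace.comap (X n) inferInstance] (X' n))
    (XL : Ω' → S') (hXL : Measurable XL)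
    (hFsXL : Measurable[MeasurableSpace.comap XL inferInstance] Fs)
    -- joint weak convergence of the conditional cdfs and of `X' n`
    (hconv : RandomLimitBootstrap.WeakConv P Q
      (fun n ω =>
        (RandomLimitBootstrap.randomCondCdf (P n) (fun ω => τ n (D n ω)) (X n) ω,
          RandomLimitBootstrap.randomCondCdf (P n) (fun ω => τs n (D n ω, W n ω)) (D n) ω,
          X' n ω))
      (fun ω => (F ω, Fs ω, XL ω)))
    -- `E{F(u) | F*} = F*(u)` for every `u`
    (hE : ∀ u : ℝ,
      Q[fun ω => F ω u | MeasurableSpace.comap Fs inferInstance] =ᵐ[Q] fun ω => Fs ω u) :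
    RandomLimitBootstrap.UnconditionallyValid P D
      (fun n ω => τ n (D n ω)) (fun n ω => τs n (D n ω, W n ω)) := by
  refine RandomLimitBootstrap.unconditionallyValid_of_tendsto_integral hD fun h K hh hb => ?_
  have hXm : ∀ n, Measurable (X n) := fun n => (hX n).mono (hD n).comap_le le_rfl
  have hX'm : ∀ n, Measurable (X' n) := fun n => (hX' n).mono (hXm n).comap_le le_rfl
  have hτsm : ∀ n, Measurable fun ω => τs n (D n ω, W n ω) := fun n =>
    (hτs n).comp ((hD n).prodMk (hW n))
  rw [Metric.tendsto_atTop]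
  intro ε hε
  obtain ⟨N, u, g, hu, herr⟩ := RandomLimitBootstrap.exists_integral_cellError_le (F := F)
    hFs hXL hFsXL hh hb (show 0 < ε / 5 by positivity)
  have hlim := RandomLimitBootstrap.abs_integral_sub_integral_cellSum_le hF hFs hXL hE hh hb hu g
    (N := N)
  have hsum := hconv.tendsto_integral
    (RandomLimitBootstrap.exists_abs_cellSum_le (N := N) (u := u) (g := g))
    (hF.2.mono fun ω hω => RandomLimitBootstrap.continuousAt_cellSum hω.2)
    (fun n => RandomLimitBootstrap.aemeasurable_cellSum
      (fun t => (RandomLimitBootstrap.measurable_randomCondCdf _ (hXm n) t).aemeasurable)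
      (hX'm n).aemeasurable)
  have her := hconv.tendsto_integral
    (RandomLimitBootstrap.exists_abs_cellError_le (N := N) (u := u) (K := K) (g := g) hb)
    (hFs.2.mono fun ω hω => RandomLimitBootstrap.continuousAt_cellError hω.2 hh.continuous)
    (fun n => RandomLimitBootstrap.aemeasurable_cellError
      (fun t => (RandomLimitBootstrap.measurable_randomCondCdf _ (hD n) t).aemeasurable)
      (hX'm n).aemeasurable hh.continuous)
  obtain ⟨n₁, h₁⟩ := Metric.tendsto_atTop.1 hsum (ε / 5) (by positivity)
  obtain ⟨n₂, h₂⟩ := Metric.tendsto_atTop.1 her (ε / 5) (by positivity)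
  refine ⟨max n₁ n₂, fun n hn => ?_⟩
  have e₁ := h₁ n ((le_max_left _ _).trans hn)
  have e₂ := h₂ n ((le_max_right _ _).trans hn)
  have e₃ := RandomLimitBootstrap.abs_integral_pValue_sub_le (P := P n) (hD n) (hτ n) (hτsm n)
    (hXm n) (hX' n) hh hb hu g (N := N)
  rw [Real.dist_eq] at e₁ e₂ ⊢
  rw [abs_lt] at *
  rw [abs_le] at e₃ hlim
  constructor <;> linarith [e₁.1, e₁.2, e₂.1, e₂.2, e₃.1, e₃.2, hlim.1, hlim.2]
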